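/- A hyperbolic space is a geodesic metric space (not necessarily proper) that is $\delta$-hyperbolic in the sense of Gromov for some $\delta\ge 0$. An isometry $g$ of a hyperbolic space $X$ is loxodromic if for some $x\in X$ the map $\mathbb{Z}\to X$, $n\mapsto g^n x$, is a quasi-isometric embedding. A group has Property (NL) if no action of it by isometries on a hyperbolic space has a loxodromic element. A quasimorphism on a group $A$ is a map $q:A\to\mathbb{R}$ such that $|q(gh)-q(g)-q(h)|$ is bounded over all $g,h\in A$. **Theorem.** Let $B$ be a group acting on a set $S$, and let $(A_s)_{s\in S}$ be a $B$-invariant family of groups: $A_{bs}=A_s$ for all $b\in B$, $s\in S$ (or, more generally, whenever $s,t$ lie in the same $B$-orbit, $A_s$ and $A_t$ are identified by an isomorphism $\iota_{s,t}:A_s\to A_t$, where $\iota_{s,s}=\mathrm{id}$ and $\iota_{t,u}\circ\iota_{s,t}=\iota_{s,u}$). Let $\bigoplus_{s\in S}A_s$ be the group of finitely supported families $(a_s)_{s\in S}$, let $B$ act on it by permuting the factors, $(b\cdot a)_s=\iota_{b^{-1}s,\,s}(a_{b^{-1}s})$, and let $G=\bigl(\bigoplus_{s\in S}A_s\bigr)\rtimes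 B$ be the corresponding semidirect product. Then $G$ has Property (NL) if and only if all of the following hold: 1. $B$ has Property (NL); 2. for every $s\in S$ fixed by $B$, the group $A_s$ has Property (NL); 3. for every $s\in S$ with a finite $B$-orbit, every quasimorphism $A_s\to\mathbb{R}$ is bounded; 4. for every $s\in S$ with an infinite $B$-orbit, every homomorphism $A_s\to\mathbb{R}$ is bounded. -/

import Mathlib

universe u v w

/-- The Gromov product `(x | y)_o` of two points of a metric space, based at `o`. -/
noncomputable def gromovProduct {X : Type*} [MetricSpace X] (x y o : X) : ℝ :=
  (dist x o + dist y o - dist x y) / 2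

/-- Any two points of `X` are joined by a geodesic, that is, by an isometrically embedded segment
of length equal to their distance. -/
def IsGeodesicMetricSpace (X : Type*) [MetricSpace X] : Prop :=
  ∀ x y : X, ∃ γ : ℝ → X, γ 0 = x ∧ γ (dist x y) = y ∧
    ∀ s ∈ Set.Icc 0 (dist x y), ∀ t ∈ Set.Icc 0 (dist x y), dist (γ s) (γ t) = |s - t|

/-- A hyperbolic space in the sense of Gromov: a geodesic metric space (not assumed to be proper)
such that, for some `δ ≥ 0`, the Gromov product satisfies the `δ`-ultrametric inequality. -/
def IsHyperbolicSpace (X : Type*) [MetricSpace X] : Prop :=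
  IsGeodesicMetricSpace X ∧ ∃ δ : ℝ, 0 ≤ δ ∧ ∀ x y z o : X,
    min (gromovProduct x y o) (gromovProduct y z o) - δ ≤ gromovProduct x z o

/-- `g` acts loxodromically on `X`: for some point `x`, the orbit map `n ↦ g ^ n • x` is a
quasi-isometric embedding of `ℤ` into `X`. -/
def IsLoxodromic {G X : Type*} [Group G] [MetricSpace X] [MulAction G X] (g : G) : Prop :=
  ∃ x : X, ∃ K C : ℝ, 1 ≤ K ∧ 0 ≤ C ∧ ∀ m n : ℤ,
    |(m : ℝ) - n| / K - C ≤ dist (g ^ m • x) (g ^ n • x) ∧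
      dist (g ^ m • x) (g ^ n • x) ≤ K * |(m : ℝ) - n| + C

/-- Property (NL), "no loxodromics": no action of `G` by isometries on a hyperbolic space admits a
loxodromic element. The spaces range over `Type y`, which should be at least as large as the
universe of `G`. -/
def PropertyNL.{y, x} (G : Type x) [Group G] : Prop :=
  ∀ (X : Type y) [MetricSpace X] [MulAction G X] [IsIsometricSMul G X],
    IsHyperbolicSpace X → ∀ g : G, ¬ IsLoxodromic (X := X) g

/-- `q : A → ℝ` is a quasimorphism. -/
def IsQuasimorphism {A : Type*} [Group A] (q : A → ℝ) : Prop :=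
  ∃ D : ℝ, ∀ g h : A, |q (g * h) - q g - q h| ≤ D

/-- `q : A → ℝ` is a bounded function. -/
def IsBoundedFunction {A : Type*} (q : A → ℝ) : Prop :=
  ∃ C : ℝ, ∀ g : A, |q g| ≤ C

/-- `A` has no unbounded quasimorphism. -/
def NoUnboundedQuasimorphism (A : Type*) [Group A] : Prop :=
  ∀ q : A → ℝ, IsQuasimorphism q → IsBoundedFunction q

/-- `A` has no unbounded homomorphism to the additive group `ℝ`. -/
def NoUnboundedHomToReal (A : Type*) [Group A] : Prop :=
  ∀ f : A →* Multiplicative ℝ, IsBoundedFunction fun a => (f a).toAdd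

/-- A `B`-invariant family of groups `(A s)_{s ∈ S}`: the groups indexed by points of the same
`B`-orbit are the same group, up to a coherent system of identifications. When `A t` and `A s` are
literally equal for `t` in the orbit of `s`, the identifications are the identity maps. -/
structure InvariantFamily (B : Type*) {S : Type*} [Group B] [MulAction B S]
    (A : S → Type*) [∀ s, Group (A s)] where
  /-- The identification of `A s` with `A t`, for `t` in the orbit of `s`. -/
  ident : ∀ s t : S, t ∈ MulAction.orbit B s → (A s ≃* A t)
  ident_self : ∀ (s : S) (h : s ∈ MulAction.orbit B s) (a : A s), ident s s h a = a
  ident_trans : ∀ (s t u : S) (hst : t ∈ MulAction.orbit B s) (htu : u ∈ MulAction.orbit B t)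
    (hsu : u ∈ MulAction.orbit B s) (a : A s), ident t u htu (ident s t hst a) = ident s u hsu a

/-- The direct sum `⨁ s, A s` of a family of (not necessarily commutative) groups: the finitely
supported elements of the product. -/
def directSumSubgroup {S : Type*} (A : S → Type*) [∀ s, Group (A s)] : Subgroup (∀ s, A s) where
  carrier := {f | {s | f s ≠ 1}.Finite}
  one_mem' := by simp
  mul_mem' := by
    intro f g hf hg
    refine (Set.Finite.union hf hg).subset ?_
    intro s hs
    by_contra h
    simp only [Set.mem_union, Set.mem_ofPred_eq, not_or, not_not] at h
    exact hs (by simp [h.1, h.2])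
  inv_mem' := by
    intro f hf
    simpa using hf

namespace InvariantFamily

variable {B : Type*} {S : Type*} [Group B] [MulAction B S] {A : S → Type*} [∀ s, Group (A s)]

theorem mem_orbit_inv_smul (b : B) (s : S) : s ∈ MulAction.orbit B (b⁻¹ • s) :=
  ⟨b, by simp⟩

/-- The action of `b : B` on the product by permutation of the factors: the factor with index
`b⁻¹ • s` is moved to the factor with index `s`. -/
def permuteFun (F : InvariantFamily B A) (b : B) (f : ∀ s, A s) : ∀ s, A s :=
  fun s => F.ident (b⁻¹ • s) s (mem_orbit_inv_smul b s) (f (b⁻¹ • s))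

theorem ident_congr (F : InvariantFamily B A) (f : ∀ s, A s) {r r' s : S} (h : r = r')
    (hr : s ∈ MulAction.orbit B r) (hr' : s ∈ MulAction.orbit B r') :
    F.ident r s hr (f r) = F.ident r' s hr' (f r') := by
  subst h; rfl

theorem permuteFun_one (F : InvariantFamily B A) (f : ∀ s, A s) : F.permuteFun 1 f = f := by
  funext s
  have h := F.ident_congr f (r := (1 : B)⁻¹ • s) (r' := s) (s := s) (by simp)
    (mem_orbit_inv_smul 1 s) (MulAction.mem_orbit_self s)
  exact h.trans (F.ident_self s _ _)

theorem permuteFun_permuteFun (F : InvariantFamily B A) (b c : B) (f : ∀ s, A s) :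
    F.permuteFun b (F.permuteFun c f) = F.permuteFun (b * c) f := by
  funext s
  have hs : s ∈ MulAction.orbit B (c⁻¹ • b⁻¹ • s) := ⟨b * c, by simp [mul_smul]⟩
  refine (F.ident_trans (c⁻¹ • b⁻¹ • s) (b⁻¹ • s) s _ _ hs _).trans ?_
  exact F.ident_congr f (by simp [mul_smul]) _ _

theorem permuteFun_mul (F : InvariantFamily B A) (b : B) (f g : ∀ s, A s) :
    F.permuteFun b (f * g) = F.permuteFun b f * F.permuteFun b g := by
  funext s
  simp [permuteFun]

theorem permuteFun_mem (F : InvariantFamily B A) (b : B) {f : ∀ s, A s}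
    (hf : f ∈ directSumSubgroup A) : F.permuteFun b f ∈ directSumSubgroup A := by
  change {s | F.permuteFun b f s ≠ 1}.Finite
  refine (Set.Finite.image (fun s => b • s) hf).subset ?_
  intro s hs
  refine ⟨b⁻¹ • s, ?_, by simp⟩
  intro h
  exact hs (by simp [permuteFun, h])

/-- The action of `B` on the direct sum `⨁ s, A s` by permutation of the factors. -/
def permute (F : InvariantFamily B A) : B →* MulAut (directSumSubgroup A) where
  toFun b :=
    { toFun := fun f => ⟨F.permuteFun b f, F.permuteFun_mem b f.2⟩
      invFun := fun f => ⟨F.permuteFun b⁻¹ f, F.permuteFun_mem b⁻¹ f.2⟩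
      left_inv := fun f => Subtype.ext <| by
        simp [permuteFun_permuteFun, permuteFun_one]
      right_inv := fun f => Subtype.ext <| by
        simp [permuteFun_permuteFun, permuteFun_one]
      map_mul' := fun f g => Subtype.ext <| F.permuteFun_mul b f g }
  map_one' := by
    ext1 f
    exact Subtype.ext (F.permuteFun_one f)
  map_mul' b c := by
    ext1 f
    exact Subtype.ext (F.permuteFun_permuteFun b c f).symm

/-- The semidirect product `(⨁ s, A s) ⋊ B` in which `B` acts by permutation of the factors. -/
abbrev PermutationalProduct (F : InvariantFamily B A) : Type _ :=
  directSumSubgroup A ⋊[F.permute] B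

end InvariantFamily

open Filter Topology

/-! An isometry is loxodromic exactly when its stable translation length `τ` is positive.

Necessity. An unbounded quasimorphism makes a group act on a quasi-line with a loxodromic element,
so (NL) rules out unbounded quasimorphisms; (NL) also passes to the quotients `B` and, for fixed
`s`, `A s`. A homogeneous quasimorphism on `A s` can be summed over the coordinates of a finite
orbit to give a quasimorphism of the whole product. A homomorphism has no defect, so it can be
summed over any orbit.

Sufficiency. The centralizer of a loxodromic element fixes a point at infinity, and its homogenized
Busemann function `φ` is a quasimorphism with `|φ| = τ`. If `a` in `A s` is loxodromic and `s` is
not fixed, a conjugate of `a` lies in another factor, hence is centralized by `A s`; so `φ` is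
unbounded on `A s`. If the orbit is infinite, `φ` lives on infinitely many commuting copies of `A
s`; its defects on them are summable, so its limit along the copies is an unbounded homomorphism.
Thus no factor contains a loxodromic element, and neither does the direct sum `N`, since `τ` is
subadditive on commuting elements.

It remains to pass from `N` and `B` to `N B` (`not_isLoxodromic_mul`). If the orbits of `N` are
bounded, `N` does not affect `τ`. Otherwise normality forces the whole group to fix a point at
infinity, and the Busemann quasimorphism vanishes on `N` and on `B`, hence everywhere. -/

theorem bddBelow_dist_pow_div {G X : Type*} [Group G] [MetricSpace X] [MulAction G X] (g : G)
    (o : X) : BddBelow (Set.range fun n : ℕ => dist (g ^ n • o) o / n) :=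
  ⟨0, by rintro _ ⟨n, rfl⟩; positivity⟩

/-! ### Stable translation length -/

section TranslationLength

variable {G X : Type*} [Group G] [MetricSpace X] [MulAction G X] [IsIsometricSMul G X]

theorem dist_mul_smul_le (g h : G) (o : X) :
    dist ((g * h) • o) o ≤ dist (g • o) o + dist (h • o) o := by
  have h1 := dist_triangle ((g * h) • o) (g • o) o
  rw [mul_smul, dist_smul] at h1
  rw [mul_smul]
  linarith

theorem dist_inv_smul_self (g : G) (o : X) : dist (g⁻¹ • o) o = dist (g • o) o := by
  rw [← dist_smul g (g⁻¹ • o) o, smul_inv_smul, dist_comm]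

theorem subadditive_dist_pow (g : G) (o : X) : Subadditive fun n : ℕ => dist (g ^ n • o) o := by
  intro m n
  simpa only [pow_add] using dist_mul_smul_le (g ^ m) (g ^ n) o

/-- The stable translation length `lim d(g ^ n o, o) / n` of `g`. -/
noncomputable def translationLength (g : G) (o : X) : ℝ := (subadditive_dist_pow g o).lim

theorem tendsto_translationLength (g : G) (o : X) :
    Tendsto (fun n : ℕ => dist (g ^ n • o) o / n) atTop (𝓝 (translationLength g o)) :=
  (subadditive_dist_pow g o).tendsto_lim (bddBelow_dist_pow_div g o)

theorem translationLength_nonneg (g : G) (o : X) : 0 ≤ translationLength g o :=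
  ge_of_tendsto' (tendsto_translationLength g o) fun n => by positivity

theorem mul_translationLength_le (g : G) (o : X) (n : ℕ) :
    n * translationLength g o ≤ dist (g ^ n • o) o := by
  rcases Nat.eq_zero_or_pos n with rfl | hn
  · simp
  · have h := (subadditive_dist_pow g o).lim_le_div (bddBelow_dist_pow_div g o) hn.ne'
    rwa [le_div_iff₀ (by exact_mod_cast hn), mul_comm] at h

theorem dist_pow_smul_le (g : G) (o : X) (n : ℕ) :
    dist (g ^ n • o) o ≤ n * dist (g • o) o := by
  induction n with
  | zero => simp
  | succ n ih =>
    have := dist_mul_smul_le (g ^ n) g o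
    rw [← pow_succ] at this
    push_cast
    linarith

/-- Comparison of translation lengths along sequences which differ by a bounded amount. -/
theorem tendsto_div_of_abs_sub_le {u v : ℕ → ℝ} {l C : ℝ}
    (hu : Tendsto (fun n : ℕ => u n / n) atTop (𝓝 l)) (h : ∀ n, |v n - u n| ≤ C) :
    Tendsto (fun n : ℕ => v n / n) atTop (𝓝 l) := by
  have h0 : Tendsto (fun n : ℕ => C / (n : ℝ)) atTop (𝓝 0) := tendsto_const_div_atTop_nhds_zero_nat C
  have h1 : Tendsto (fun n : ℕ => (v n - u n) / n) atTop (𝓝 0) := by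
    refine squeeze_zero_norm (fun n => ?_) h0
    rw [Real.norm_eq_abs, abs_div, Nat.abs_cast]
    exact div_le_div_of_nonneg_right (h n) (Nat.cast_nonneg n)
  simpa [← add_div] using h1.add hu

theorem abs_dist_smul_sub_le (g : G) (o o' : X) :
    |dist (g • o') o' - dist (g • o) o| ≤ 2 * dist o o' := by
  have h1 := dist_triangle4 (g • o') (g • o) o o'
  have h2 := dist_triangle4 (g • o) (g • o') o' o
  simp only [dist_smul] at h1 h2
  rw [dist_comm o' o] at h1 h2
  rw [abs_le]
  constructor <;> linarith

theorem translationLength_eq_of_basepoint (g : G) (o o' : X) :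
    translationLength g o' = translationLength g o :=
  tendsto_nhds_unique (tendsto_translationLength g o')
    (tendsto_div_of_abs_sub_le (tendsto_translationLength g o)
      fun n => abs_dist_smul_sub_le (g ^ n) o o')

theorem translationLength_conj (b g : G) (o : X) :
    translationLength (b * g * b⁻¹) o = translationLength g o := by
  rw [← translationLength_eq_of_basepoint g o (b⁻¹ • o)]
  refine tendsto_nhds_unique (tendsto_translationLength _ o) ?_
  refine (tendsto_translationLength g (b⁻¹ • o)).congr fun n => ?_
  rw [conj_pow, mul_smul, mul_smul, ← dist_smul b, smul_inv_smul]

theorem translationLength_one (o : X) : translationLength (1 : G) o = 0 :=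
  tendsto_nhds_unique (tendsto_translationLength (1 : G) o) (by simp)

theorem translationLength_mul_le_of_commute {g h : G} (hgh : Commute g h) (o : X) :
    translationLength (g * h) o ≤ translationLength g o + translationLength h o := by
  refine le_of_tendsto_of_tendsto' (tendsto_translationLength (g * h) o)
    ((tendsto_translationLength g o).add (tendsto_translationLength h o)) fun n => ?_
  rw [← add_div, hgh.mul_pow]
  exact div_le_div_of_nonneg_right (dist_mul_smul_le _ _ _) (Nat.cast_nonneg n)

theorem dist_zpow_smul_zpow_smul (g : G) (o : X) (m n : ℤ) :
    dist (g ^ m • o) (g ^ n • o) = dist (g ^ (m - n).natAbs • o) o := by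
  have h : dist (g ^ m • o) (g ^ n • o) = dist (g ^ (m - n) • o) o := by
    rw [← dist_smul (g ^ n) (g ^ (m - n) • o), ← mul_smul, ← zpow_add]
    congr 3; ring
  rw [h]
  rcases Int.natAbs_eq (m - n) with hk | hk
  · conv_lhs => rw [hk, zpow_natCast]
  · conv_lhs => rw [hk, zpow_neg, zpow_natCast, dist_inv_smul_self]

theorem isLoxodromic_of_translationLength_pos {g : G} {o : X} (h : 0 < translationLength g o) :
    IsLoxodromic (X := X) g := by
  set τ := translationLength g o
  set L := dist (g • o) o
  have hL : 0 ≤ L := dist_nonneg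
  -- The bounds `k τ ≤ d(g ^ k o, o) ≤ k L` need only `K ≥ 1 / τ` and `K ≥ L`, with no additive
  -- constant.
  refine ⟨o, 1 + 1 / τ + L, 0, ?_, le_rfl, fun m n => ?_⟩
  · have : 0 < 1 / τ := by positivity
    linarith
  have hk : |(m : ℝ) - n| = ((m - n).natAbs : ℝ) := by
    rw [Nat.cast_natAbs]; push_cast; rfl
  rw [dist_zpow_smul_zpow_smul, hk]
  set k := (m - n).natAbs
  have h1 : (k : ℝ) * τ ≤ dist (g ^ k • o) o := mul_translationLength_le g o k
  have h2 : dist (g ^ k • o) o ≤ k * L := dist_pow_smul_le g o k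
  have hk0 : (0 : ℝ) ≤ k := Nat.cast_nonneg k
  have hτ : 0 < 1 / τ := by positivity
  constructor
  · rw [sub_zero, div_le_iff₀ (by positivity)]
    have : (k : ℝ) = k * τ * (1 / τ) := by field_simp
    calc (k : ℝ) = k * τ * (1 / τ) := this
      _ ≤ dist (g ^ k • o) o * (1 + 1 / τ + L) := by
        gcongr; linarith
  · have : 0 ≤ (1 + 1 / τ) * k := by positivity
    nlinarith

theorem IsLoxodromic.translationLength_pos {g : G} (h : IsLoxodromic (X := X) g) (o : X) :
    0 < translationLength g o := by
  obtain ⟨x, K, C, hK, hC, h⟩ := h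
  rw [← translationLength_eq_of_basepoint g o x]
  have hK0 : 0 < K := by linarith
  refine lt_of_lt_of_le (one_div_pos.2 hK0) ?_
  have h1 : Tendsto (fun n : ℕ => (n / K - C) / (n : ℝ)) atTop (𝓝 (1 / K)) := by
    refine tendsto_div_of_abs_sub_le (u := fun n => n / K) (C := C) ?_ fun n => ?_
    · refine tendsto_const_nhds.congr' ?_
      filter_upwards [eventually_gt_atTop 0] with n hn
      field_simp
    · simp [abs_of_nonneg hC]
  refine le_of_tendsto_of_tendsto' h1 (tendsto_translationLength g x) fun n => ?_
  have := (h n 0).1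
  simp only [zpow_natCast, zpow_zero, one_smul, Int.cast_natCast, Int.cast_zero, sub_zero,
    Nat.abs_cast] at this
  exact div_le_div_of_nonneg_right this (Nat.cast_nonneg n)

theorem translationLength_eq_zero_of_not_isLoxodromic {g : G} (h : ¬ IsLoxodromic (X := X) g)
    (o : X) : translationLength g o = 0 :=
  le_antisymm (not_lt.1 fun h' => h (isLoxodromic_of_translationLength_pos h'))
    (translationLength_nonneg g o)

/-- The translation length only depends on the isometry. -/
theorem translationLength_congr {H : Type*} [Group H] [MulAction H X] [IsIsometricSMul H X]
    {g : G} {h : H} (hgh : ∀ x : X, g • x = h • x) (o : X) :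
    translationLength g o = translationLength h o := by
  refine tendsto_nhds_unique (tendsto_translationLength g o)
    ((tendsto_translationLength h o).congr fun n => ?_)
  have : ∀ x : X, g ^ n • x = h ^ n • x := by
    induction n with
    | zero => simp
    | succ n ih => intro x; rw [pow_succ, pow_succ, mul_smul, mul_smul, hgh, ih]
  rw [this]

end TranslationLength

/-! ### Homogeneous quasimorphisms -/

section Quasimorphism

variable {G : Type*} [Group G]

/-- A homogeneous quasimorphism of defect at most `D`. -/
structure IsHomogeneousQuasimorphism (φ : G → ℝ) (D : ℝ) : Prop where
  defect : ∀ g h, |φ (g * h) - φ g - φ h| ≤ D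
  map_mul_of_commute : ∀ {g h}, Commute g h → φ (g * h) = φ g + φ h

namespace IsHomogeneousQuasimorphism

variable {φ : G → ℝ} {D : ℝ}

theorem map_one (hφ : IsHomogeneousQuasimorphism φ D) : φ 1 = 0 := by
  simpa using hφ.map_mul_of_commute (Commute.one_left (1 : G))

theorem map_inv (hφ : IsHomogeneousQuasimorphism φ D) (g : G) : φ g⁻¹ = -φ g := by
  have := hφ.map_mul_of_commute (Commute.inv_left (Commute.refl g))
  rw [inv_mul_cancel, hφ.map_one] at this
  linarith

theorem map_pow (hφ : IsHomogeneousQuasimorphism φ D) (g : G) (n : ℕ) : φ (g ^ n) = n * φ g := by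
  induction n with
  | zero => simpa using hφ.map_one
  | succ n ih =>
    rw [pow_succ, hφ.map_mul_of_commute ((Commute.refl g).pow_left n), ih]
    push_cast
    ring

end IsHomogeneousQuasimorphism

/-- Fekete's lemma applies because `q (g ^ n) + D` is subadditive. For commuting elements `(g h) ^ n
= g ^ n h ^ n`, so the error `D` disappears after division by `n`. The defect `4 * D` is `D` plus
three replacements of `q` by its limit. -/
theorem exists_homogenization {q : G → ℝ} {D : ℝ}
    (hq : ∀ g h, |q (g * h) - q g - q h| ≤ D) :
    ∃ φ : G → ℝ, (∀ g, Tendsto (fun n : ℕ => q (g ^ n) / n) atTop (𝓝 (φ g))) ∧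
      (∀ g, |φ g - q g| ≤ D) ∧ IsHomogeneousQuasimorphism φ (4 * D) := by
  have hsub : ∀ g, Subadditive fun n : ℕ => q (g ^ n) + D := by
    intro g m n
    have := (abs_le.1 (hq (g ^ m) (g ^ n))).2
    simp only [pow_add]
    linarith
  have hD : 0 ≤ D := (abs_nonneg _).trans (hq 1 1)
  have hlin : ∀ g (n : ℕ), |q (g ^ (n + 1)) - (n + 1) * q g| ≤ n * D := by
    intro g n
    induction n with
    | zero => simp
    | succ n ih =>
      have h1 := abs_le.1 (hq (g ^ (n + 1)) g)
      have h2 := abs_le.1 ih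
      rw [← pow_succ] at h1
      rw [abs_le]
      push_cast
      constructor <;> linarith
  have hbdd : ∀ g, BddBelow (Set.range fun n : ℕ => (q (g ^ n) + D) / n) := by
    intro g
    refine ⟨-(|q g| + D), ?_⟩
    rintro _ ⟨n, rfl⟩
    rcases n with _ | n
    · simp only [Nat.cast_zero, div_zero]
      linarith [abs_nonneg (q g)]
    · have h1 := (abs_le.1 (hlin g n)).1
      have h2 : ((n : ℝ) + 1) * -|q g| ≤ (n + 1) * q g :=
        mul_le_mul_of_nonneg_left (neg_abs_le _) (by positivity)
      push_cast
      rw [le_div_iff₀ (by positivity)]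
      linarith
  have hlim : ∀ g, Tendsto (fun n : ℕ => q (g ^ n) / n) atTop (𝓝 (hsub g).lim) := fun g =>
    tendsto_div_of_abs_sub_le (C := D) ((hsub g).tendsto_lim (hbdd g)) fun n => by
      rw [show q (g ^ n) - (q (g ^ n) + D) = -D by ring, abs_neg, abs_of_nonneg hD]
  have hclose : ∀ g, |(hsub g).lim - q g| ≤ D := by
    intro g
    refine le_of_tendsto (((hlim g).comp (tendsto_add_atTop_nat 1)).sub_const (q g)).abs
      (Eventually.of_forall fun n => ?_)
    have h0 : (0 : ℝ) < n + 1 := by positivity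
    have h1 : q (g ^ (n + 1)) / ((n + 1 : ℕ) : ℝ) - q g
        = (q (g ^ (n + 1)) - (n + 1) * q g) / (n + 1) := by
      push_cast
      field_simp
    rw [Function.comp_apply, h1, abs_div, abs_of_pos h0, div_le_iff₀ h0]
    linarith [hlin g n]
  refine ⟨fun g => (hsub g).lim, hlim, hclose, fun g h => ?_, fun {g h} hgh => ?_⟩
  · have h1 := abs_le.1 (hclose (g * h))
    have h2 := abs_le.1 (hclose g)
    have h3 := abs_le.1 (hclose h)
    have h4 := abs_le.1 (hq g h)
    rw [abs_le]
    constructor <;> linarith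
  · refine tendsto_nhds_unique (hlim (g * h)) ?_
    have h1 : Tendsto (fun n : ℕ => (q (g ^ n) + q (h ^ n)) / n) atTop
        (𝓝 ((hsub g).lim + (hsub h).lim)) := by
      simpa only [add_div] using (hlim g).add (hlim h)
    refine tendsto_div_of_abs_sub_le (C := D) h1 fun n => ?_
    rw [hgh.mul_pow, ← sub_sub]
    exact hq _ _

end Quasimorphism

/-! ### Isometries of hyperbolic spaces and points at infinity -/

/-- The four-point condition, equivalent to the `δ`-ultrametric inequality for Gromov products. -/
def FourPointCondition (X : Type*) [MetricSpace X] (δ : ℝ) : Prop :=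
  ∀ x y z o : X, dist x z + dist y o ≤ dist x y + dist z o + 2 * δ ∨
    dist x z + dist y o ≤ dist y z + dist x o + 2 * δ

theorem IsHyperbolicSpace.exists_fourPointCondition {X : Type*} [MetricSpace X]
    (h : IsHyperbolicSpace X) : ∃ δ : ℝ, 0 ≤ δ ∧ FourPointCondition X δ := by
  obtain ⟨-, δ, hδ, h⟩ := h
  refine ⟨δ, hδ, fun x y z o => ?_⟩
  have := h x y z o
  unfold gromovProduct at this
  rcases min_choice ((dist x o + dist y o - dist x y) / 2) ((dist y o + dist z o - dist y z) / 2)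
    with h1 | h1 <;> rw [h1] at this
  · left; linarith
  · right; linarith

theorem FourPointCondition.gromovProduct_le {X : Type*} [MetricSpace X] {δ : ℝ}
    (h : FourPointCondition X δ) (x y z o : X) :
    gromovProduct x y o - δ ≤ gromovProduct x z o ∨
      gromovProduct y z o - δ ≤ gromovProduct x z o := by
  unfold gromovProduct
  rcases h x y z o with h | h
  · left; linarith
  · right; linarith

theorem gromovProduct_comm {X : Type*} [MetricSpace X] (x y o : X) :
    gromovProduct x y o = gromovProduct y x o := by
  unfold gromovProduct
  rw [dist_comm x y]; ring

section Hyperbolic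

variable {G X : Type*} [Group G] [MetricSpace X] [MulAction G X] [IsIsometricSMul G X] {δ : ℝ}

/-- The four-point condition on `o`, `g o`, `g² o`, `g ^ (n + 2) o` shows inductively that each
further power moves the orbit away from `o` by at least the excess `ε`. Hence the translation length
is at least `ε`. -/
theorem isLoxodromic_of_dist_sq (hX : FourPointCondition X δ) {g : G} {o : X}
    (hg : dist (g • o) o + 2 * δ < dist (g ^ 2 • o) o) : IsLoxodromic (X := X) g := by
  set ε := dist (g ^ 2 • o) o - dist (g • o) o - 2 * δ with hε
  have hε0 : 0 < ε := by linarith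
  have hδ : 0 ≤ δ := by
    have := hX o o o o
    simp only [dist_self] at this
    rcases this with h | h <;> linarith
  have key : ∀ n : ℕ, dist (g ^ n • o) o + ε ≤ dist (g ^ (n + 1) • o) o ∨ n = 0 := by
    intro n
    induction n with
    | zero => right; rfl
    | succ n ih =>
      left
      have h1 : dist (g ^ n • o) o ≤ dist (g ^ (n + 1) • o) o := by
        rcases ih with h | rfl
        · linarith
        · simp
      have e1 : dist (g • o) (g ^ (n + 2) • o) = dist (g ^ (n + 1) • o) o := by
        rw [show g ^ (n + 2) = g * g ^ (n + 1) by rw [← pow_succ'], mul_smul, dist_smul, dist_comm]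
      have e2 : dist (g ^ 2 • o) (g ^ (n + 2) • o) = dist (g ^ n • o) o := by
        rw [show g ^ (n + 2) = g ^ 2 * g ^ n by rw [← pow_add, add_comm], mul_smul, dist_smul,
          dist_comm]
      have e3 : dist (g • o) (g ^ 2 • o) = dist (g • o) o := by
        rw [pow_two, mul_smul, dist_smul, dist_comm]
      have h2 := hX o (g • o) (g ^ 2 • o) (g ^ (n + 2) • o)
      rw [e1, e2, e3, dist_comm o, dist_comm o, dist_comm o] at h2
      rw [show n + 1 + 1 = n + 2 from rfl]
      rcases h2 with h2 | h2 <;> linarith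
  have lin : ∀ n : ℕ, (n - 1) * ε ≤ dist (g ^ n • o) o := by
    intro n
    induction n with
    | zero => simp; linarith
    | succ n ih =>
      rcases key n with h | rfl
      · push_cast; linarith
      · simp
  refine isLoxodromic_of_translationLength_pos (o := o) (hε0.trans_le ?_)
  have h1 : Tendsto (fun n : ℕ => ((n : ℝ) - 1) * ε / n) atTop (𝓝 ε) := by
    refine tendsto_div_of_abs_sub_le (u := fun n => n * ε) (C := ε) ?_ fun n => ?_
    · refine tendsto_const_nhds.congr' ?_
      filter_upwards [eventually_gt_atTop 0] with n hn
      field_simp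
    · rw [show ((n : ℝ) - 1) * ε - n * ε = -ε by ring, abs_neg, abs_of_pos hε0]
  exact le_of_tendsto_of_tendsto' h1 (tendsto_translationLength g o) fun n =>
    div_le_div_of_nonneg_right (lin n) (Nat.cast_nonneg n)

/-- If the orbit points `g o` and `h o` diverge early, then one of `g`, `h`, `g⁻¹ h` is
loxodromic. -/
theorem le_gromovProduct_of_not_isLoxodromic (hX : FourPointCondition X δ) {g h : G} (o : X)
    (hg : ¬ IsLoxodromic (X := X) g) (hh : ¬ IsLoxodromic (X := X) h)
    (hgh : ¬ IsLoxodromic (X := X) (g⁻¹ * h)) :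
    min (dist (g • o) o) (dist (h • o) o) / 2 - 8 * δ ≤ gromovProduct (g • o) (h • o) o := by
  by_contra! hlt
  have hδ : 0 ≤ δ := by
    have := hX o o o o
    simp only [dist_self] at this
    rcases this with h | h <;> linarith
  have l1 := min_le_left (dist (g • o) o) (dist (h • o) o)
  have l2 := min_le_right (dist (g • o) o) (dist (h • o) o)
  have a1 := not_lt.1 fun h' => hg (isLoxodromic_of_dist_sq hX (o := o) h')
  have a2 := not_lt.1 fun h' => hh (isLoxodromic_of_dist_sq hX (o := o) h')
  have a3 := not_lt.1 fun h' => hgh (isLoxodromic_of_dist_sq hX (o := o) h')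
  have sq : ∀ k : G, dist (k • o) (k⁻¹ • o) = dist (k ^ 2 • o) o := fun k => by
    rw [← dist_smul k, smul_inv_smul, ← mul_smul, pow_two]
  have n1 := dist_inv_smul_self g o
  have n2 := dist_inv_smul_self h o
  have n3 := dist_inv_smul_self (g⁻¹ * h) o
  have s1 := sq g
  have s2 := sq h
  have s3 := sq (g⁻¹ * h)
  have d0 : dist ((g⁻¹ * h) • o) o = dist (g • o) (h • o) := by
    rw [← dist_smul g, ← mul_smul, mul_inv_cancel_left, dist_comm]
  have d1 : dist ((g⁻¹ * h) • o) (g⁻¹ • o) = dist (h • o) o := by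
    rw [mul_smul, dist_smul]
  have d2 : dist ((g⁻¹ * h)⁻¹ • o) (h⁻¹ • o) = dist (g • o) o := by
    rw [mul_inv_rev, inv_inv, mul_smul, dist_smul]
  -- Consider the chain `g o`, `g⁻¹ o`, `g⁻¹ h o`, `h⁻¹ g o`, `h⁻¹ o`, `h o`. For non-loxodromic
  -- `k`, `(k o | k⁻¹ o) ≥ d(k o, o) / 2 - δ`; moreover `(g⁻¹ o | g⁻¹ h o) = d(g o, o) - (g o | h
  -- o)`, and symmetrically for `h`. If `(g o | h o)` is small, all consecutive products are large,
  -- and four ultrametric steps make `(g o | h o)` large.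
  have p1 := hX.gromovProduct_le (g • o) (g⁻¹ • o) ((g⁻¹ * h) • o) o
  have p2 := hX.gromovProduct_le (h • o) (h⁻¹ • o) ((g⁻¹ * h)⁻¹ • o) o
  have p3 := hX.gromovProduct_le (g • o) ((g⁻¹ * h) • o) (h • o) o
  have p4 := hX.gromovProduct_le ((g⁻¹ * h) • o) ((g⁻¹ * h)⁻¹ • o) (h • o) o
  rw [gromovProduct_comm ((g⁻¹ * h)⁻¹ • o)] at p4
  unfold gromovProduct at *
  rw [dist_comm (g⁻¹ • o) ((g⁻¹ * h) • o)] at p1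
  rw [dist_comm (h⁻¹ • o) ((g⁻¹ * h)⁻¹ • o)] at p2
  simp only [n1, n2, n3, s1, s2, s3, d0, d1, d2] at *
  rcases p1 with p1 | p1 <;> rcases p2 with p2 | p2 <;> rcases p3 with p3 | p3 <;>
    rcases p4 with p4 | p4 <;> linarith

/-- `G` fixes the point at infinity represented by the sequence `y`. -/
def FixesLimit (G : Type*) {X : Type*} [Group G] [MetricSpace X] [MulAction G X] (y : ℕ → X)
    (o : X) : Prop :=
  ∀ (g : G) (R : ℝ), ∀ᶠ i in atTop, R ≤ gromovProduct (g • y i) (y i) o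

theorem exists_tendsto_hyperfilter {ι : Type*} [Infinite ι] {f : ι → ℝ} {C : ℝ}
    (h : ∀ i, |f i| ≤ C) : ∃ l, Tendsto f (hyperfilter ι) (𝓝 l) := by
  obtain ⟨l, -, hl⟩ := (isCompact_Icc (a := -C) (b := C)).ultrafilter_le_nhds
    ((hyperfilter ι).map f) (le_principal_iff.2 (Ultrafilter.mem_map.2 (univ_mem' fun i => abs_le.1 (h i))))
  exact ⟨l, hl⟩

/-- The Busemann quasimorphism of a group fixing a point at infinity of a hyperbolic space: up to
sign, it computes the translation length. -/
theorem FixesLimit.exists_isHomogeneousQuasimorphism (hX : FourPointCondition X δ) {y : ℕ → X}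
    {o : X} (hy : FixesLimit G y o) :
    ∃ (φ : G → ℝ) (D : ℝ), IsHomogeneousQuasimorphism φ D ∧
      ∀ g, |φ g| = translationLength g o := by
  -- Busemann function of `y`. The distance differences need not converge, so the limit is taken
  -- along an ultrafilter.
  have hb : ∀ x, ∃ l, Tendsto (fun i => dist x (y i) - dist o (y i)) (hyperfilter ℕ) (𝓝 l) :=
    fun x => exists_tendsto_hyperfilter fun i => abs_dist_sub_le x o (y i)
  choose b hb using hb
  have hev : ∀ {p : ℕ → Prop}, (∀ᶠ i in atTop, p i) → ∀ᶠ i in (hyperfilter ℕ : Filter ℕ), p i :=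
    fun hp => Nat.hyperfilter_le_atTop hp
  have hble : ∀ x, |b x| ≤ dist x o := fun x =>
    le_of_tendsto (hb x).abs (Eventually.of_forall fun i => abs_dist_sub_le x o (y i))
  have hq : ∀ g h : G, |b ((g * h) • o) - b (g • o) - b (h • o)| ≤ 2 * δ := by
    intro g h
    refine le_of_tendsto (((hb ((g * h) • o)).sub (hb (g • o))).sub (hb (h • o))).abs
      -- The threshold excludes, by the triangle inequality, the four-point alternative involving
      -- `d(h o, o) + d(y i, g⁻¹ y i)`.
      (hev ((hy g⁻¹ (dist (h • o) o + δ + 1)).mono fun i hi => ?_))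
    have e1 : dist ((g * h) • o) (y i) = dist (h • o) (g⁻¹ • y i) := by
      rw [← dist_smul g⁻¹, ← mul_smul, inv_mul_cancel_left]
    have e2 : dist (g • o) (y i) = dist o (g⁻¹ • y i) := by
      rw [← dist_smul g⁻¹, inv_smul_smul]
    rw [e1, e2]
    unfold gromovProduct at hi
    have t1 := dist_triangle o (h • o) (y i)
    have t2 := dist_triangle o (h • o) (g⁻¹ • y i)
    have f1 := hX (h • o) o (y i) (g⁻¹ • y i)
    have f2 := hX (h • o) o (g⁻¹ • y i) (y i)
    rw [dist_comm (g⁻¹ • y i) o, dist_comm (y i) o] at hi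
    rw [dist_comm (y i) (g⁻¹ • y i)] at f1
    rw [dist_comm o (h • o)] at t1 t2
    rw [abs_le]
    constructor
    · rcases f1 with f1 | f1 <;> linarith
    · rcases f2 with f2 | f2 <;> linarith
  obtain ⟨φ, hlim, hclose, hφ⟩ := exists_homogenization (q := fun g => b (g • o)) hq
  refine ⟨φ, _, hφ, fun g => le_antisymm ?_ ?_⟩
  · refine le_of_tendsto_of_tendsto' (hlim g).abs (tendsto_translationLength g o) fun n => ?_
    rw [abs_div, Nat.abs_cast]
    exact div_le_div_of_nonneg_right (hble _) (Nat.cast_nonneg n)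
  -- Doubling costs at most `n |φ g|`: `2 δ` of the error comes from the four-point condition, `4 δ`
  -- from two comparisons of `b` with `φ`. Dividing by `n` gives `2 τ ≤ τ + |φ g|`.
  · have hstep : ∀ n : ℕ, dist (g ^ (2 * n) • o) o ≤
        dist (g ^ n • o) o + n * |φ g| + 6 * δ := by
      intro n
      have hc1 := abs_le.1 (hclose (g ^ (2 * n)))
      have hc2 := abs_le.1 (hclose (g ^ n))
      rw [hφ.map_pow] at hc1 hc2
      have hn0 : (0 : ℝ) ≤ n := Nat.cast_nonneg n
      have m1 := mul_le_mul_of_nonneg_left (le_abs_self (φ g)) hn0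
      have m2 := mul_le_mul_of_nonneg_left (neg_abs_le (φ g)) hn0
      push_cast at hc1
      have hmax : dist (g ^ (2 * n) • o) o - dist (g ^ n • o) o - 2 * δ ≤
          max (b (g ^ (2 * n) • o) - b (g ^ n • o)) (- b (g ^ n • o)) := by
        refine ge_of_tendsto (((hb (g ^ (2 * n) • o)).sub (hb (g ^ n • o))).max
          (hb (g ^ n • o)).neg) (Eventually.of_forall fun i => ?_)
        have f := hX o (g ^ n • o) (g ^ (2 * n) • o) (y i)
        have e : dist (g ^ n • o) (g ^ (2 * n) • o) = dist (g ^ n • o) o := by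
          rw [two_mul, pow_add, mul_smul, dist_smul, dist_comm]
        rw [e, dist_comm o (g ^ n • o), dist_comm o (g ^ (2 * n) • o)] at f
        rw [le_max_iff]
        rcases f with f | f
        · left; linarith
        · right; linarith
      rcases le_max_iff.1 hmax with h | h <;> linarith
    have h1 : Tendsto (fun n : ℕ => dist (g ^ (2 * n) • o) o / n) atTop
        (𝓝 (2 * translationLength g o)) := by
      refine (((tendsto_translationLength g o).comp
        (tendsto_id.const_mul_atTop' (by norm_num : 0 < 2))).const_mul 2).congr fun n => ?_
      simp only [Function.comp_apply, id]
      push_cast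
      field_simp
    have h2 : Tendsto (fun n : ℕ => (dist (g ^ n • o) o + n * |φ g| + 6 * δ) / n) atTop
        (𝓝 (translationLength g o + |φ g|)) := by
      refine tendsto_div_of_abs_sub_le (u := fun n => dist (g ^ n • o) o + n * |φ g|)
        (C := |6 * δ|) ?_ fun n => by simp
      refine ((tendsto_translationLength g o).add_const |φ g|).congr' ?_
      filter_upwards [eventually_gt_atTop 0] with n hn
      field_simp
    have h3 := le_of_tendsto_of_tendsto' h1 h2 fun n =>
      div_le_div_of_nonneg_right (hstep n) (Nat.cast_nonneg n)
    linarith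

/-- The group fixes a point at infinity if it centralizes a loxodromic element. -/
theorem fixesLimit_of_commute {h : G} (hlox : IsLoxodromic (X := X) h)
    (hcomm : ∀ g : G, Commute g h) (o : X) : FixesLimit G (fun i => h ^ i • o) o := by
  intro g R
  have hτ := hlox.translationLength_pos o
  obtain ⟨n, hn⟩ := exists_nat_gt ((R + dist (g • o) o) / translationLength h o)
  filter_upwards [eventually_ge_atTop n] with i hi
  have h1 := mul_translationLength_le h o i
  have h2 : (n : ℝ) * translationLength h o ≤ i * translationLength h o := by gcongr
  rw [div_lt_iff₀ hτ] at hn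
  have h3 : dist (g • h ^ i • o) (h ^ i • o) = dist (g • o) o := by
    rw [← mul_smul, ((hcomm g).pow_right i).eq, mul_smul, dist_smul]
  have h4 := dist_triangle_left (h ^ i • o) o (g • h ^ i • o)
  rw [h3] at h4
  unfold gromovProduct
  rw [h3]
  linarith [dist_nonneg (x := g • o) (y := o)]

/-- A group fixes a point at infinity if it has a normal subgroup with unbounded orbits and no
loxodromic elements. -/
theorem exists_fixesLimit_of_normal (hX : FourPointCondition X δ) (N : Subgroup G) [N.Normal]
    (hN : ∀ n ∈ N, ¬ IsLoxodromic (X := X) n) (o : X)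
    (hunb : ∀ C : ℝ, ∃ n ∈ N, C < dist (n • o) o) : ∃ y : ℕ → X, FixesLimit G y o := by
  choose n hnN hn using fun i : ℕ => hunb i
  refine ⟨fun i => n i • o, fun g R => ?_⟩
  -- Conjugation by `g` shortens the displacement of `n i` by at most `2 d(g o, o)`; replacing `g n
  -- i g⁻¹ o` by `g n i o` then costs at most `d(g o, o)` in the Gromov product.
  obtain ⟨k, hk⟩ := exists_nat_gt (2 * (R + 8 * δ + dist (g • o) o) + 2 * dist (g • o) o)
  filter_upwards [eventually_ge_atTop k] with i hi
  have hik : (k : ℝ) ≤ i := by exact_mod_cast hi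
  have hni := hn i
  have hc : g * n i * g⁻¹ ∈ N := Subgroup.Normal.conj_mem inferInstance _ (hnN i) g
  have h1 := le_gromovProduct_of_not_isLoxodromic hX o (hN _ hc) (hN _ (hnN i))
    (hN _ (N.mul_mem (N.inv_mem hc) (hnN i)))
  have e1 : dist ((g * n i * g⁻¹) • o) (g • n i • o) = dist (g • o) o := by
    rw [← dist_inv_smul_self g, mul_smul, mul_smul, dist_smul, dist_smul]
  have e2 : dist (g • n i • o) (g • o) = dist (n i • o) o := dist_smul _ _ _
  have t1 := dist_triangle ((g * n i * g⁻¹) • o) (g • n i • o) o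
  have t2 := dist_triangle_left ((g • n i • o)) o ((g * n i * g⁻¹) • o)
  have t3 := dist_triangle_right (g • n i • o) (g • o) o
  have t4 := dist_triangle_left (g • n i • o) (n i • o) ((g * n i * g⁻¹) • o)
  unfold gromovProduct at h1 ⊢
  have m : k - 2 * dist (g • o) o ≤ min (dist ((g * n i * g⁻¹) • o) o) (dist (n i • o) o) := by
    refine le_min ?_ ?_
    · linarith
    · linarith [dist_nonneg (x := g • o) (y := o)]
  linarith

/-- If neither the normal subgroup `N` nor the subset `B` contains loxodromic elements, then `N B`
does not contain any either. -/
theorem not_isLoxodromic_mul (hX : FourPointCondition X δ) (N : Subgroup G) [N.Normal]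
    (hN : ∀ n ∈ N, ¬ IsLoxodromic (X := X) n) {n b : G} (hn : n ∈ N)
    (hb : ∀ k : ℕ, ¬ IsLoxodromic (X := X) (b ^ k)) :
    ¬ IsLoxodromic (X := X) (n * b) := by
  intro hlox
  have hpow : ∀ k : ℕ, ∃ m ∈ N, (n * b) ^ k = m * b ^ k := by
    intro k
    induction k with
    | zero => exact ⟨1, N.one_mem, by simp⟩
    | succ k ih =>
      obtain ⟨m, hm, h⟩ := ih
      refine ⟨m * (b ^ k * n * (b ^ k)⁻¹),
        N.mul_mem hm (Subgroup.Normal.conj_mem inferInstance _ hn _), ?_⟩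
      rw [pow_succ, h]
      group
  obtain ⟨o, -⟩ := id hlox
  have hτ := hlox.translationLength_pos o
  by_cases hunb : ∀ C : ℝ, ∃ n ∈ N, C < dist (n • o) o
  · obtain ⟨y, hy⟩ := exists_fixesLimit_of_normal hX N hN o hunb
    obtain ⟨φ, D, hφ, habs⟩ := hy.exists_isHomogeneousQuasimorphism hX
    have h0 : ∀ g : G, ¬ IsLoxodromic (X := X) g → φ g = 0 := fun g hg => by
      rw [← abs_eq_zero, habs, translationLength_eq_zero_of_not_isLoxodromic hg]
    -- Writing `(n b) ^ k = m b ^ k` with `m ∈ N`, `φ` vanishes on both factors, so `φ ((n b) ^ k)`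
    -- is bounded by the defect although it grows linearly.
    have hbound : ∀ k : ℕ, k * translationLength (n * b) o ≤ D := by
      intro k
      obtain ⟨m, hm, h⟩ := hpow k
      have := hφ.defect m (b ^ k)
      rw [h0 _ (hN m hm), h0 _ (hb k), ← h, hφ.map_pow, sub_zero, sub_zero, abs_mul, habs,
        Nat.abs_cast] at this
      exact this
    obtain ⟨k, hk⟩ := exists_nat_gt (D / translationLength (n * b) o)
    rw [div_lt_iff₀ hτ] at hk
    linarith [hbound k]
  · push Not at hunb
    obtain ⟨C, hC⟩ := hunb
    refine hτ.ne' ?_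
    rw [← translationLength_eq_zero_of_not_isLoxodromic (by simpa using hb 1) o (g := b)]
    -- By normality, `m b ^ k o` and `b ^ k o` stay within `C` of each other, so `n b` and `b` have
    -- the same translation length.
    refine tendsto_nhds_unique (tendsto_translationLength _ o)
      (tendsto_div_of_abs_sub_le (C := C) (tendsto_translationLength b o) fun k => ?_)
    obtain ⟨m, hm, h⟩ := hpow k
    rw [h]
    refine (abs_dist_sub_le _ _ _).trans ?_
    have := hC ((b ^ k)⁻¹ * m * b ^ k) (by
      simpa using Subgroup.Normal.conj_mem inferInstance _ hm (b ^ k)⁻¹ (H := N))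
    rwa [mul_smul, mul_smul, ← dist_smul (b ^ k), smul_inv_smul, ← mul_smul] at this

end Hyperbolic

/-! ### Property (NL) and homomorphisms -/

section PropertyNL

/-- The preimages of loxodromic elements under a homomorphism are loxodromic for the restricted
action. -/
theorem PropertyNL.not_isLoxodromic_map.{y, x, x'} {H : Type x} {G : Type x'} [Group H] [Group G]
    (hH : PropertyNL.{y} H) {X : Type y} [MetricSpace X] [MulAction G X] [IsIsometricSMul G X]
    (hX : IsHyperbolicSpace X) (f : H →* G) (h : H) : ¬ IsLoxodromic (X := X) (f h) := by
  intro hlox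
  let _ : MulAction H X := MulAction.compHom X f
  have : IsIsometricSMul H X := ⟨fun k => isometry_smul X (f k)⟩
  obtain ⟨o, -⟩ := id hlox
  refine hH X hX h (isLoxodromic_of_translationLength_pos (o := o) ?_)
  rw [translationLength_congr (g := h) (h := f h) (fun _ => rfl) o]
  exact hlox.translationLength_pos o

theorem PropertyNL.of_surjective.{y, x, x'} {G : Type x} {Q : Type x'} [Group G] [Group Q]
    (hG : PropertyNL.{y} G) (f : G →* Q) (hf : Function.Surjective f) : PropertyNL.{y} Q := by
  intro X _ _ _ hX g
  obtain ⟨g, rfl⟩ := hf g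
  exact hG.not_isLoxodromic_map hX f g

end PropertyNL

/-! ### Loxodromic actions from unbounded quasimorphisms -/

section QuasiLine

variable {G : Type*} [Group G]

/-- The functions on `G` which are, uniformly, at distance at most `D` from being equivariant with
respect to `q`. If `q` is a quasimorphism, this is a quasi-line on which `G` acts. -/
@[ext]
structure QuasiLine (q : G → ℝ) (D : ℝ) where
  /-- The underlying function. -/
  toFun : G → ℝ
  abs_sub_sub_le : ∀ g h, |toFun (g * h) - toFun g - q h| ≤ D

namespace QuasiLine

variable {q : G → ℝ} {D : ℝ}

theorem abs_sub_le (φ ψ : QuasiLine q D) (h : G) :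
    |φ.1 h - ψ.1 h| ≤ |φ.1 1 - ψ.1 1| + 2 * D := by
  have h1 := φ.2 1 h
  have h2 := ψ.2 1 h
  rw [one_mul] at h1 h2
  calc |φ.1 h - ψ.1 h|
      = |(φ.1 1 - ψ.1 1) + ((φ.1 h - φ.1 1 - q h) - (ψ.1 h - ψ.1 1 - q h))| := by congr 1; ring
    _ ≤ |φ.1 1 - ψ.1 1| + (|φ.1 h - φ.1 1 - q h| + |ψ.1 h - ψ.1 1 - q h|) :=
        (abs_add_le _ _).trans (add_le_add_right (abs_sub _ _) _)
    _ ≤ |φ.1 1 - ψ.1 1| + 2 * D := by linarith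

theorem bddAbove_range (φ ψ : QuasiLine q D) :
    BddAbove (Set.range fun h => |φ.1 h - ψ.1 h|) :=
  ⟨_, by rintro _ ⟨h, rfl⟩; exact abs_sub_le φ ψ h⟩

noncomputable instance : Dist (QuasiLine q D) := ⟨fun φ ψ => ⨆ h, |φ.1 h - ψ.1 h|⟩

theorem dist_def (φ ψ : QuasiLine q D) : dist φ ψ = ⨆ h, |φ.1 h - ψ.1 h| := rfl

theorem abs_sub_le_dist (φ ψ : QuasiLine q D) (h : G) : |φ.1 h - ψ.1 h| ≤ dist φ ψ :=
  le_ciSup (bddAbove_range φ ψ) h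

theorem dist_le {φ ψ : QuasiLine q D} {C : ℝ} (hC : ∀ h, |φ.1 h - ψ.1 h| ≤ C) : dist φ ψ ≤ C :=
  ciSup_le hC

noncomputable instance : MetricSpace (QuasiLine q D) where
  dist_self φ := by simp [dist_def]
  dist_comm φ ψ := by simp only [dist_def, abs_sub_comm]
  dist_triangle φ ψ χ := dist_le fun h =>
    (_root_.abs_sub_le _ (ψ.1 h) _).trans (add_le_add (abs_sub_le_dist _ _ h) (abs_sub_le_dist _ _ h))
  eq_of_dist_eq_zero {φ ψ} h0 := QuasiLine.ext <| funext fun h => by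
    have := abs_sub_le_dist φ ψ h
    rw [h0] at this
    exact sub_eq_zero.1 (abs_nonpos_iff.1 this)

instance : MulAction G (QuasiLine q D) where
  smul g φ := ⟨fun h => φ.1 (g⁻¹ * h), fun k h => by
    have := φ.2 (g⁻¹ * k) h; rwa [mul_assoc] at this⟩
  one_smul φ := QuasiLine.ext <| funext fun h => by
    change φ.1 (1⁻¹ * h) = φ.1 h
    simp
  mul_smul g g' φ := QuasiLine.ext <| funext fun h => by
    change φ.1 ((g * g')⁻¹ * h) = φ.1 (g'⁻¹ * (g⁻¹ * h))
    simp [mul_assoc]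

theorem smul_apply (g : G) (φ : QuasiLine q D) (h : G) : (g • φ).1 h = φ.1 (g⁻¹ * h) := rfl

instance : IsIsometricSMul G (QuasiLine q D) :=
  ⟨fun g => Isometry.of_dist_eq fun φ ψ => by
    simp only [dist_def, smul_apply]
    exact (Equiv.mulLeft g⁻¹).iSup_comp (g := fun h => |φ.1 h - ψ.1 h|)⟩

/-- The defining inequalities are convex, so affine interpolation stays in the space and is a
geodesic for the sup distance. -/
theorem isGeodesicMetricSpace : IsGeodesicMetricSpace (QuasiLine q D) := by
  intro φ ψ
  set d := dist φ ψ with hd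
  have hd0 : 0 ≤ d := dist_nonneg
  let c : ℝ → Set.Icc (0 : ℝ) 1 := fun t => Set.projIcc 0 1 zero_le_one (t / d)
  have hc : ∀ t ∈ Set.Icc 0 d, (c t : ℝ) = t / d := fun t ht => by
    simp only [c]
    rw [Set.projIcc_of_mem zero_le_one ⟨div_nonneg ht.1 hd0, div_le_one_of_le₀ ht.2 hd0⟩]
  let γ : ℝ → QuasiLine q D := fun t =>
    ⟨fun h => (1 - c t) * φ.1 h + c t * ψ.1 h, fun g h => by
      have h0 := (c t).2.1
      have h1 := (c t).2.2
      have a1 := abs_le.1 (φ.2 g h)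
      have a2 := abs_le.1 (ψ.2 g h)
      rw [abs_le]
      constructor <;> nlinarith⟩
  have hγ : ∀ t h, (γ t).1 h = (1 - c t) * φ.1 h + c t * ψ.1 h := fun _ _ => rfl
  refine ⟨γ, QuasiLine.ext <| funext fun h => ?_, QuasiLine.ext <| funext fun h => ?_,
    fun s hs t ht => ?_⟩
  · rw [hγ, hc 0 ⟨le_rfl, hd0⟩]
    simp
  · rw [hγ, hc d ⟨hd0, le_rfl⟩]
    rcases hd0.eq_or_lt with h0 | h0
    · rw [dist_eq_zero.1 (hd.symm.trans h0.symm)]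
      ring
    · rw [div_self h0.ne']
      ring
  · have key : ∀ h, |(γ s).1 h - (γ t).1 h| = |s / d - t / d| * |φ.1 h - ψ.1 h| := fun h => by
      rw [hγ, hγ, hc s hs, hc t ht, ← abs_mul, ← abs_neg]
      congr 1
      ring
    rw [dist_def]
    simp only [key]
    rw [← Real.mul_iSup_of_nonneg (abs_nonneg _), ← dist_def, ← hd, ← sub_div, abs_div,
      abs_of_nonneg hd0]
    rcases hd0.eq_or_lt with h0 | h0
    · rw [← h0] at hs ht ⊢
      have e1 := le_antisymm hs.2 hs.1
      have e2 := le_antisymm ht.2 ht.1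
      simp [e1, e2]
    · field_simp

/-- Evaluation at `1` preserves distances up to `2 |D|`, so the four-point inequality is inherited
from the real line. -/
theorem isHyperbolicSpace : IsHyperbolicSpace (QuasiLine q D) := by
  refine ⟨isGeodesicMetricSpace, 3 * |D|, by positivity, fun x y z o => ?_⟩
  have hD := le_abs_self D
  have upper : ∀ φ ψ : QuasiLine q D, dist φ ψ ≤ |φ.1 1 - ψ.1 1| + 2 * |D| := fun φ ψ =>
    dist_le fun h => (abs_sub_le φ ψ h).trans (by linarith)
  have lower : ∀ φ ψ : QuasiLine q D, |φ.1 1 - ψ.1 1| ≤ dist φ ψ := fun φ ψ =>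
    abs_sub_le_dist φ ψ 1
  have u1 := upper x z
  have u2 := upper y o
  have l1 := lower x y
  have l2 := lower z o
  have l3 := lower y z
  have l4 := lower x o
  have b1 := le_abs_self (x.1 1 - y.1 1)
  have b2 := neg_abs_le (x.1 1 - y.1 1)
  have b3 := le_abs_self (z.1 1 - o.1 1)
  have b4 := neg_abs_le (z.1 1 - o.1 1)
  have b5 := le_abs_self (y.1 1 - z.1 1)
  have b6 := neg_abs_le (y.1 1 - z.1 1)
  have b7 := le_abs_self (x.1 1 - o.1 1)
  have b8 := neg_abs_le (x.1 1 - o.1 1)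
  have hD0 := abs_nonneg D
  rw [sub_le_iff_le_add, min_le_iff]
  unfold gromovProduct
  rcases abs_cases (x.1 1 - z.1 1) with ⟨e1, -⟩ | ⟨e1, -⟩ <;>
    rcases abs_cases (y.1 1 - o.1 1) with ⟨e2, -⟩ | ⟨e2, -⟩ <;> rw [e1] at u1 <;> rw [e2] at u2
  · right; linarith
  · left; linarith
  · left; linarith
  · right; linarith

end QuasiLine

/-- A group with Property (NL) has no unbounded quasimorphism. -/
theorem PropertyNL.noUnboundedQuasimorphism.{x} {G : Type x} [Group G]
    (hG : PropertyNL.{x} G) : NoUnboundedQuasimorphism G := by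
  rintro q ⟨D, hq⟩
  obtain ⟨φ, -, hclose, hφ⟩ := exists_homogenization hq
  refine ⟨D, fun g => ?_⟩
  suffices h : φ g = 0 by simpa [h] using hclose g
  by_contra hne
  -- `φ` itself is a point of the quasi-line, and `g ^ n` changes its value at `1` from `0` to `-n φ
  -- g`.
  let o : QuasiLine φ (4 * D) := ⟨φ, hφ.defect⟩
  refine hG (QuasiLine φ (4 * D)) QuasiLine.isHyperbolicSpace g
    (isLoxodromic_of_translationLength_pos (o := o) ((abs_pos.2 hne).trans_le ?_))
  refine ge_of_tendsto (tendsto_translationLength g o) ?_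
  filter_upwards [eventually_gt_atTop 0] with n hn
  have h := QuasiLine.abs_sub_le_dist (g ^ n • o) o 1
  rw [QuasiLine.smul_apply, mul_one] at h
  change |φ _ - φ 1| ≤ _ at h
  rw [hφ.map_one, sub_zero, hφ.map_inv, hφ.map_pow, abs_neg, abs_mul, Nat.abs_cast] at h
  rwa [le_div_iff₀ (by exact_mod_cast hn), mul_comm]

end QuasiLine

/-! ### Centralizers of loxodromic elements -/

section Centralizer

variable {G X : Type*} [Group G] [MetricSpace X] [MulAction G X] [IsIsometricSMul G X] {δ : ℝ}

theorem IsLoxodromic.exists_isHomogeneousQuasimorphism (hX : FourPointCondition X δ) {h : G}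
    (hlox : IsLoxodromic (X := X) h) (o : X) :
    ∃ (φ : Subgroup.centralizer {h} → ℝ) (D : ℝ), IsHomogeneousQuasimorphism φ D ∧
      ∀ g, |φ g| = translationLength (g : G) o := by
  have : IsIsometricSMul (Subgroup.centralizer {h}) X := ⟨fun g => isometry_smul X (g : G)⟩
  let h' : Subgroup.centralizer {h} := ⟨h, Subgroup.mem_centralizer_singleton_iff.2 rfl⟩
  have hτ : ∀ g : Subgroup.centralizer {h}, translationLength g o = translationLength (g : G) o :=
    fun g => translationLength_congr (fun _ => rfl) o
  have hlox' : IsLoxodromic (X := X) h' :=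
    isLoxodromic_of_translationLength_pos (o := o) (by
      rw [hτ]; exact hlox.translationLength_pos o)
  have hfix := fixesLimit_of_commute hlox' (fun g => Subtype.ext
    (Subgroup.mem_centralizer_singleton_iff.1 g.2)) o
  obtain ⟨φ, D, hφ, habs⟩ := hfix.exists_isHomogeneousQuasimorphism hX
  exact ⟨φ, D, hφ, fun g => (habs g).trans (hτ g)⟩

end Centralizer

/-! ### Quasimorphisms on infinitely many commuting copies -/

section CommutingFamily

variable {A H ι : Type*} [Group A] [Group H] {j : ι → A →* H} {φ : H → ℝ} {D : ℝ}

/-- For the products `a` of the `j t x` and `b` of the `j t y`, commutation makes `a * b` the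
product of the `j t (x * y)`; additivity of `φ` on commuting elements turns the sum of defects into
the single defect at `(a, b)`. -/
theorem IsHomogeneousQuasimorphism.abs_sum_defect_le (hφ : IsHomogeneousQuasimorphism φ D)
    (hj : ∀ s t, s ≠ t → ∀ x y, Commute (j s x) (j t y)) (x y : A) (F : Finset ι) :
    |∑ t ∈ F, (φ (j t (x * y)) - φ (j t x) - φ (j t y))| ≤ D := by
  classical
  have key : ∃ a b : H, (∀ t ∉ F, ∀ z, Commute (j t z) a) ∧ (∀ t ∉ F, ∀ z, Commute (j t z) b) ∧
      φ (a * b) = ∑ t ∈ F, φ (j t (x * y)) ∧ φ a = ∑ t ∈ F, φ (j t x) ∧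
      φ b = ∑ t ∈ F, φ (j t y) := by
    induction F using Finset.induction_on with
    | empty => exact ⟨1, 1, by simp, by simp, by simp [hφ.map_one]⟩
    | insert t F ht ih =>
      obtain ⟨a, b, ha, hb, hab, ha', hb'⟩ := ih
      refine ⟨j t x * a, j t y * b, ?_, ?_, ?_, ?_, ?_⟩
      · intro s hs z
        rw [Finset.mem_insert, not_or] at hs
        exact (hj s t hs.1 z x).mul_right (ha s hs.2 z)
      · intro s hs z
        rw [Finset.mem_insert, not_or] at hs
        exact (hj s t hs.1 z y).mul_right (hb s hs.2 z)
      · have : j t x * a * (j t y * b) = j t (x * y) * (a * b) := by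
          rw [map_mul, mul_assoc, ← mul_assoc a, ← (ha t ht y).eq]
          simp only [mul_assoc]
        rw [this, hφ.map_mul_of_commute ((ha t ht _).mul_right (hb t ht _)), hab,
          Finset.sum_insert ht]
      · rw [hφ.map_mul_of_commute (ha t ht x), ha', Finset.sum_insert ht]
      · rw [hφ.map_mul_of_commute (hb t ht y), hb', Finset.sum_insert ht]
  obtain ⟨a, b, -, -, hab, ha, hb⟩ := key
  rw [Finset.sum_sub_distrib, Finset.sum_sub_distrib, ← hab, ← ha, ← hb]
  exact hφ.defect a b

/-- A homogeneous quasimorphism on a group containing infinitely many commuting copies of `A`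
has asymptotically trivial defect on these copies. -/
theorem IsHomogeneousQuasimorphism.tendsto_defect_cofinite
    (hφ : IsHomogeneousQuasimorphism φ D)
    (hj : ∀ s t, s ≠ t → ∀ x y, Commute (j s x) (j t y)) (x y : A) :
    Tendsto (fun t => φ (j t (x * y)) - φ (j t x) - φ (j t y)) cofinite (𝓝 0) := by
  have hsum := hφ.abs_sum_defect_le hj x y
  set d : ι → ℝ := fun t => φ (j t (x * y)) - φ (j t x) - φ (j t y)
  have hs : Summable fun t => |d t| := by
    refine summable_of_sum_le (c := 2 * D) (fun t => abs_nonneg _) fun F => ?_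
    -- Bounding the nonnegative and the negative defects separately gives absolute summability.
    rw [← Finset.sum_filter_add_sum_filter_not F fun t => 0 ≤ d t]
    have h1 := (abs_le.1 (hsum (F.filter fun t => 0 ≤ d t))).2
    have h2 := (abs_le.1 (hsum (F.filter fun t => ¬ 0 ≤ d t))).1
    rw [Finset.sum_congr rfl fun t ht => abs_of_nonneg (Finset.mem_filter.1 ht).2,
      Finset.sum_congr (s₁ := F.filter fun t => ¬ 0 ≤ d t) rfl fun t ht =>
        abs_of_neg (not_le.1 (Finset.mem_filter.1 ht).2), Finset.sum_neg_distrib]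
    change ∑ t ∈ _, d t ≤ D at h1
    change -D ≤ ∑ t ∈ _, d t at h2
    linarith
  exact (tendsto_zero_iff_abs_tendsto_zero _).2 hs.tendsto_cofinite_zero

theorem IsHomogeneousQuasimorphism.exists_monoidHom [Infinite ι]
    (hφ : IsHomogeneousQuasimorphism φ D)
    (hj : ∀ s t, s ≠ t → ∀ x y, Commute (j s x) (j t y)) {T : A → ℝ}
    (hT : ∀ t x, |φ (j t x)| = T x) : ∃ f : A →* Multiplicative ℝ, ∀ x, |(f x).toAdd| = T x := by
  have hlim : ∀ x, ∃ l, Tendsto (fun t => φ (j t x)) (hyperfilter ι) (𝓝 l) := fun x =>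
    exists_tendsto_hyperfilter fun t => (hT t x).le
  choose f hf using hlim
  refine ⟨MonoidHom.mk' (fun x => Multiplicative.ofAdd (f x)) fun x y => ?_, fun x => ?_⟩
  · have h1 := ((hf (x * y)).sub (hf x)).sub (hf y)
    have h2 := tendsto_nhds_unique h1
      ((hφ.tendsto_defect_cofinite hj x y).mono_left hyperfilter_le_cofinite)
    rw [← ofAdd_add]
    congr 1
    linarith
  · refine tendsto_nhds_unique (hf x).abs ?_
    simp only [hT]
    exact tendsto_const_nhds

end CommutingFamily

/-! ### Factors of the permutational product -/

namespace InvariantFamily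

variable {B : Type*} {S : Type*} [Group B] [MulAction B S] {A : S → Type*} [∀ s, Group (A s)]

open Classical in
/-- The inclusion of a factor in the direct sum. -/
noncomputable def single (A : S → Type*) [∀ s, Group (A s)] (s : S) :
    A s →* directSumSubgroup A :=
  (MonoidHom.mulSingle A s).codRestrict _ fun a =>
    (Set.finite_singleton s).subset fun t ht => by
      by_contra hne
      exact ht (Pi.mulSingle_eq_of_ne hne a)

theorem single_same (s : S) (a : A s) : (single A s a).1 s = a := by
  classical
  exact Pi.mulSingle_eq_same s a

theorem single_of_ne {s t : S} (h : t ≠ s) (a : A s) : (single A s a).1 t = 1 := by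
  classical
  exact Pi.mulSingle_eq_of_ne h a

theorem commute_single_of_apply_eq_one {s : S} (a : A s) {f : directSumSubgroup A}
    (hf : f.1 s = 1) : Commute (single A s a) f := by
  refine Subtype.ext (funext fun t => ?_)
  change (single A s a).1 t * f.1 t = f.1 t * (single A s a).1 t
  by_cases h : t = s
  · subst h
    rw [hf, mul_one, one_mul]
  · rw [single_of_ne h, mul_one, one_mul]

/-- The condition `f.1 s = 1` makes the split-off factor commute with the remainder. -/
theorem directSum_induction {p : directSumSubgroup A → Prop} (one : p 1)
    (single_mul : ∀ (s : S) (a : A s) (f : directSumSubgroup A), f.1 s = 1 → p f →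
      p (single A s a * f)) (f : directSumSubgroup A) : p f := by
  classical
  suffices h : ∀ (I : Finset S) (f : directSumSubgroup A), (∀ s ∉ I, f.1 s = 1) → p f by
    refine h (Set.Finite.toFinset f.2) f fun s hs => ?_
    by_contra hne
    exact hs ((Set.Finite.mem_toFinset _).2 hne)
  intro I
  induction I using Finset.induction_on with
  | empty =>
    intro f hf
    rw [show f = 1 from Subtype.ext (funext fun s => hf s (Finset.notMem_empty s))]
    exact one
  | insert s I _ ih =>
    intro f hf
    have hval : ∀ t, ((single A s (f.1 s))⁻¹ * f).1 t = ((single A s (f.1 s)).1 t)⁻¹ * f.1 t :=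
      fun t => rfl
    have h1 : ((single A s (f.1 s))⁻¹ * f).1 s = 1 := by
      rw [hval, single_same, inv_mul_cancel]
    have h2 := single_mul s (f.1 s) _ h1 (ih ((single A s (f.1 s))⁻¹ * f) fun t ht => by
      by_cases hts : t = s
      · subst hts
        exact h1
      · rw [hval, single_of_ne hts, inv_one, one_mul]
        exact hf t (by simp [hts, ht]))
    rwa [mul_inv_cancel_left] at h2

variable (F : InvariantFamily B A)

/-- The inclusion of a factor in the permutational product. -/
noncomputable def incl (s : S) : A s →* F.PermutationalProduct :=
  SemidirectProduct.inl.comp (single A s)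

theorem permute_single (b : B) (s : S) (a : A s) :
    F.permute b (single A s a) = single A (b • s) (F.ident s (b • s) (MulAction.mem_orbit s b) a) := by
  refine Subtype.ext (funext fun t => ?_)
  change F.ident (b⁻¹ • t) t _ ((single A s a).1 (b⁻¹ • t)) = _
  by_cases h : t = b • s
  · subst h
    rw [single_same]
    refine (F.ident_congr (single A s a).1 (inv_smul_smul b s) _ (MulAction.mem_orbit s b)).trans ?_
    rw [single_same]
  · rw [single_of_ne h, single_of_ne (fun h' => h (inv_smul_eq_iff.1 h')), map_one]

theorem inr_mul_incl_mul_inr_inv (b : B) (s : S) (a : A s) :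
    SemidirectProduct.inr b * F.incl s a * (SemidirectProduct.inr b)⁻¹ =
      F.incl (b • s) (F.ident s (b • s) (MulAction.mem_orbit s b) a) := by
  rw [incl, incl, MonoidHom.comp_apply, MonoidHom.comp_apply, ← permute_single,
    SemidirectProduct.inl_aut, map_inv]

theorem commute_incl {s t : S} (h : s ≠ t) (a : A s) (a' : A t) :
    Commute (F.incl s a) (F.incl t a') :=
  (commute_single_of_apply_eq_one a (single_of_ne h a')).map SemidirectProduct.inl

/-! ### Summing functions over an orbit -/

section Coordinates

variable {F}

/-- The coordinates of an element of the permutational product along an orbit, as elements of a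
single group. -/
def coord (g : F.PermutationalProduct) (s : S) (t : MulAction.orbit B s) : A s :=
  F.ident t s (MulAction.mem_orbit_symm.1 t.2) (g.left.1 t)

theorem coord_mul (g h : F.PermutationalProduct) (s : S) (t : MulAction.orbit B s) :
    coord (g * h) s t = coord g s t * coord h s (g.right⁻¹ • t) := by
  change F.ident _ _ _ (g.left.1 t * F.ident (g.right⁻¹ • (t : S)) t _ _) = _
  rw [map_mul]
  exact congrArg (coord g s t * ·) (F.ident_trans (g.right⁻¹ • (t : S)) t s _ _
    (MulAction.mem_orbit_symm.1 (g.right⁻¹ • t).2) _)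

theorem coord_incl_self (s : S) (a : A s) :
    coord (F.incl s a) s ⟨s, MulAction.mem_orbit_self s⟩ = a := by
  change F.ident s s _ ((single A s a).1 s) = a
  rw [single_same, F.ident_self]

theorem coord_incl_of_ne (s : S) (a : A s) (t : MulAction.orbit B s)
    (ht : t ≠ ⟨s, MulAction.mem_orbit_self s⟩) : coord (F.incl s a) s t = 1 := by
  change F.ident t s _ ((single A s a).1 t) = 1
  rw [single_of_ne (fun h => ht (Subtype.ext h)), map_one]

theorem finite_coord_ne_one (g : F.PermutationalProduct) (s : S) :
    {t | coord g s t ≠ 1}.Finite := by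
  have h : {s | g.left.1 s ≠ 1}.Finite := g.left.2
  refine (h.preimage Subtype.val_injective.injOn).subset fun t ht h0 => ht ?_
  change g.left.1 t = 1 at h0
  rw [coord, h0, map_one]

variable (F)

/-- The projection to a factor whose index is fixed by `B`. -/
def evalFixed (s : S) (hs : s ∈ MulAction.fixedPoints B S) : F.PermutationalProduct →* A s :=
  MonoidHom.mk' (fun g => coord g s ⟨s, MulAction.mem_orbit_self s⟩) fun g h => by
    rw [coord_mul]
    congr 2
    exact Subtype.ext (hs _)

theorem evalFixed_surjective (s : S) (hs : s ∈ MulAction.fixedPoints B S) :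
    Function.Surjective (F.evalFixed s hs) :=
  fun a => ⟨F.incl s a, coord_incl_self s a⟩

/-- A function on a factor whose defects can be summed over the orbit is bounded if the
permutational product has no unbounded quasimorphism. -/
theorem isBoundedFunction_of_finsum_defect (hF : NoUnboundedQuasimorphism F.PermutationalProduct)
    {s : S} {q : A s → ℝ} (h1 : q 1 = 0) {C : ℝ}
    (hC : ∀ v w : MulAction.orbit B s → A s,
      |∑ᶠ t, (q (v t * w t) - q (v t) - q (w t))| ≤ C) : IsBoundedFunction q := by
  have hsupp : ∀ v : MulAction.orbit B s → A s, {t | v t ≠ 1}.Finite →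
      (Function.support fun t => q (v t)).Finite := fun v hv =>
    hv.subset fun t ht h => ht (by simp [h, h1])
  obtain ⟨K, hK⟩ := hF (fun g => ∑ᶠ t, q (coord g s t)) ⟨C, fun g h => by
    -- Reindexing absorbs the permutation by `g.right`, so the defect of the sum is the sum of the
    -- coordinate defects.
    have e : ∑ᶠ t, q (coord h s t) = ∑ᶠ t, q (coord h s (g.right⁻¹ • t)) :=
      (finsum_comp_equiv (MulAction.toPerm g.right⁻¹)).symm
    have f1 := hsupp _ (finite_coord_ne_one (g * h) s)
    have f2 := hsupp _ (finite_coord_ne_one g s)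
    have f3 : (Function.support fun t => q (coord h s (g.right⁻¹ • t))).Finite :=
      (hsupp _ (finite_coord_ne_one h s)).preimage
        (MulAction.injective (β := MulAction.orbit B s) g.right⁻¹).injOn
    beta_reduce
    rw [e, ← finsum_sub_distrib f1 f2, ← finsum_sub_distrib ((f1.union f2).subset
      (Function.support_sub _ _)) f3]
    simp only [coord_mul]
    exact hC _ _⟩
  refine ⟨K, fun a => ?_⟩
  have := hK (F.incl s a)
  beta_reduce at this
  rwa [finsum_eq_single _ (⟨s, MulAction.mem_orbit_self s⟩ : MulAction.orbit B s)
    (fun t ht => by rw [coord_incl_of_ne s a t ht, h1]), coord_incl_self] at this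

theorem noUnboundedQuasimorphism_of_finite_orbit
    (hF : NoUnboundedQuasimorphism F.PermutationalProduct) {s : S}
    (hs : (MulAction.orbit B s).Finite) : NoUnboundedQuasimorphism (A s) := by
  rintro q ⟨D, hq⟩
  have := hs.fintype
  -- Homogenizing ensures that the function vanishes at `1`, so that its sum over coordinates is
  -- finitely supported.
  obtain ⟨φ, -, hclose, hφ⟩ := exists_homogenization hq
  obtain ⟨K, hK⟩ := F.isBoundedFunction_of_finsum_defect hF hφ.map_one
    (C := ∑ _t : MulAction.orbit B s, 4 * D) fun v w => by
      rw [finsum_eq_sum_of_fintype]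
      exact (Finset.abs_sum_le_sum_abs _ _).trans (Finset.sum_le_sum fun t _ => hφ.defect _ _)
  refine ⟨K + D, fun a => ?_⟩
  have h1 := abs_le.1 (hK a)
  have h2 := abs_le.1 (hclose a)
  rw [abs_le]
  constructor <;> linarith

theorem noUnboundedHomToReal (hF : NoUnboundedQuasimorphism F.PermutationalProduct) (s : S) :
    NoUnboundedHomToReal (A s) := fun f =>
  F.isBoundedFunction_of_finsum_defect hF (by simp) (C := 0) fun v w => by simp

end Coordinates

/-! ### Excluding loxodromic elements from the direct sum -/

section NoLoxodromic

variable {X : Type*} [MetricSpace X] [MulAction F.PermutationalProduct X]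
  [IsIsometricSMul F.PermutationalProduct X] {δ : ℝ}

theorem translationLength_incl_ident {s t : S} (ht : t ∈ MulAction.orbit B s) (a : A s) (o : X) :
    translationLength (F.incl t (F.ident s t ht a)) o = translationLength (F.incl s a) o := by
  obtain ⟨b, rfl⟩ := id ht
  rw [← translationLength_conj (SemidirectProduct.inr b) (F.incl s a),
    inr_mul_incl_mul_inr_inv]

/-- A loxodromic element in a factor `A s` with `s` not fixed by `B` yields an unbounded
quasimorphism on `A s` if the orbit of `s` is finite, and an unbounded homomorphism if it is
infinite. -/
theorem not_isLoxodromic_incl (hX : FourPointCondition X δ) {s : S}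
    (hs : s ∉ MulAction.fixedPoints B S)
    (hfin : (MulAction.orbit B s).Finite → NoUnboundedQuasimorphism (A s))
    (hinf : (MulAction.orbit B s).Infinite → NoUnboundedHomToReal (A s)) (a : A s) :
    ¬ IsLoxodromic (X := X) (F.incl s a) := by
  intro hlox
  obtain ⟨o, -⟩ := id hlox
  obtain ⟨b, hb⟩ : ∃ b : B, b • s ≠ s := by simpa [MulAction.mem_fixedPoints] using hs
  set t₀ := b • s with ht₀
  have ht₀s : t₀ ∈ MulAction.orbit B s := MulAction.mem_orbit s b
  have hτ := hlox.translationLength_pos o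
  -- This conjugate of `a` lies in a factor different from `A s`, so its centralizer contains `A s`
  -- and every other factor except its own.
  have hlox₀ : IsLoxodromic (X := X) (F.incl t₀ (F.ident s t₀ ht₀s a)) :=
    isLoxodromic_of_translationLength_pos (o := o) (by rwa [translationLength_incl_ident])
  obtain ⟨φ, D, hφ, habs⟩ := hlox₀.exists_isHomogeneousQuasimorphism hX o
  have hmem : ∀ t, t ≠ t₀ → ∀ x : A t,
      F.incl t x ∈ Subgroup.centralizer {F.incl t₀ (F.ident s t₀ ht₀s a)} := fun t ht x =>
    Subgroup.mem_centralizer_singleton_iff.2 (F.commute_incl ht _ _).eq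
  have hunb : ∀ C : ℝ, ∃ n : ℕ, C < n * translationLength (F.incl s a) o := fun C => by
    obtain ⟨n, hn⟩ := exists_nat_gt (C / translationLength (F.incl s a) o)
    exact ⟨n, (div_lt_iff₀ hτ).1 hn⟩
  by_cases horb : (MulAction.orbit B s).Finite
  · let k : A s →* _ := (F.incl s).codRestrict _ (hmem s hb.symm)
    obtain ⟨C, hC⟩ := hfin horb (fun x => φ (k x)) ⟨D, fun x y => by
      beta_reduce
      rw [map_mul]
      exact hφ.defect _ _⟩
    obtain ⟨n, hn⟩ := hunb C
    have := hC (a ^ n)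
    beta_reduce at this
    rw [map_pow, hφ.map_pow, abs_mul, habs, Nat.abs_cast] at this
    exact absurd this (not_le.2 hn)
  · let ι := ↥(MulAction.orbit B s \ {t₀})
    have : Infinite ι := (Set.Infinite.sdiff horb (Set.finite_singleton t₀)).to_subtype
    let j : ι → A s →* Subgroup.centralizer {F.incl t₀ (F.ident s t₀ ht₀s a)} := fun t =>
      ((F.incl t).comp (F.ident s t t.2.1).toMonoidHom).codRestrict _ fun x => hmem t t.2.2 _
    -- The copies of an `x` in `A s` are conjugate, hence `|φ|` takes the same value on all of them.
    obtain ⟨f, hf⟩ := hφ.exists_monoidHom (j := j) (T := fun x => translationLength (F.incl s x) o)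
      (fun t t' htt' x y => Subtype.ext (F.commute_incl (fun h => htt' (Subtype.ext h)) _ _).eq)
      fun t x => (habs _).trans (F.translationLength_incl_ident t.2.1 x o)
    obtain ⟨C, hC⟩ := hinf horb f
    obtain ⟨n, hn⟩ := hunb C
    have := hC (a ^ n)
    simp only [map_pow, toAdd_pow, nsmul_eq_mul, abs_mul, Nat.abs_cast, hf] at this
    exact absurd this (not_le.2 hn)

theorem not_isLoxodromic_inl
    (hA : ∀ (s : S) (a : A s), ¬ IsLoxodromic (X := X) (F.incl s a)) (f : directSumSubgroup A) :
    ¬ IsLoxodromic (X := X) (SemidirectProduct.inl f : F.PermutationalProduct) := by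
  intro hlox
  obtain ⟨o, -⟩ := id hlox
  refine (hlox.translationLength_pos o).ne' ?_
  refine directSum_induction (p := fun f =>
    translationLength (SemidirectProduct.inl f : F.PermutationalProduct) o = 0) ?_ ?_ f
  · rw [map_one, translationLength_one]
  · intro s a f hf h0
    refine le_antisymm ?_ (translationLength_nonneg _ o)
    rw [map_mul]
    refine (translationLength_mul_le_of_commute
      ((commute_single_of_apply_eq_one a hf).map SemidirectProduct.inl) o).trans ?_
    rw [h0, add_zero]
    exact (translationLength_eq_zero_of_not_isLoxodromic (hA s a) o).le

end NoLoxodromic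

end InvariantFamily

theorem mainTheorem8 {B : Type u} {S : Type v} [Group B] [MulAction B S]
    {A : S → Type w} [∀ s, Group (A s)] (F : InvariantFamily B A) :
    PropertyNL.{max u v w} F.PermutationalProduct ↔
      PropertyNL.{max u v w} B ∧
      (∀ s : S, s ∈ MulAction.fixedPoints B S → PropertyNL.{max u v w} (A s)) ∧
      (∀ s : S, (MulAction.orbit B s).Finite → NoUnboundedQuasimorphism (A s)) ∧
      (∀ s : S, (MulAction.orbit B s).Infinite → NoUnboundedHomToReal (A s)) := by
  constructor
  · intro hG
    have hq := hG.noUnboundedQuasimorphism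
    exact ⟨hG.of_surjective SemidirectProduct.rightHom SemidirectProduct.rightHom_surjective,
      fun s hs => hG.of_surjective (F.evalFixed s hs) (F.evalFixed_surjective s hs),
      fun s hs => F.noUnboundedQuasimorphism_of_finite_orbit hq hs,
      fun s _ => F.noUnboundedHomToReal hq s⟩
  · rintro ⟨hB, hfix, hfin, hinf⟩ X _ _ _ hX g
    obtain ⟨δ, -, hδ⟩ := hX.exists_fourPointCondition
    have hA : ∀ (s : S) (a : A s), ¬ IsLoxodromic (X := X) (F.incl s a) := by
      intro s a
      by_cases hs : s ∈ MulAction.fixedPoints B S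
      · exact (hfix s hs).not_isLoxodromic_map hX (F.incl s) a
      · exact F.not_isLoxodromic_incl hδ hs (hfin s) (hinf s) a
    have : (SemidirectProduct.inl : directSumSubgroup A →* F.PermutationalProduct).range.Normal := by
      rw [SemidirectProduct.range_inl_eq_ker_rightHom]
      infer_instance
    rw [← SemidirectProduct.inl_left_mul_inr_right g]
    refine not_isLoxodromic_mul hδ
      (SemidirectProduct.inl : directSumSubgroup A →* F.PermutationalProduct).range ?_ ⟨_, rfl⟩
      fun k => ?_
    · rintro _ ⟨f, rfl⟩
      exact F.not_isLoxodromic_inl hA f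
    · rw [← map_pow]
      exact hB.not_isLoxodromic_map hX SemidirectProduct.inr (g.right ^ k)
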